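/- Let $A$ be a unital simple $C^*$-algebra with a unique normalized trace (tracial state) $\tau$. An $A$-$A$-equivalence bimodule is an $A$-$A$-bimodule $\mathcal E$ that is a full left Hilbert $A$-module under ${}_A\langle\cdot,\cdot\rangle$ and a full right Hilbert $A$-module under $\langle\cdot,\cdot\rangle_A$, with ${}_A\langle\xi,\eta\rangle\zeta=\xi\langle\eta,\zeta\rangle_A$ for all $\xi,\eta,\zeta\in\mathcal E$. Let $\mathrm{Pic}(A)$ be the set of classes $[\mathcal E]$ of such bimodules, up to linear bijections preserving both actions and both inner products, with product $[\mathcal E_1][\mathcal E_2]=[\mathcal E_1\otimes_A\mathcal E_2]$ (interior tensor product), and let $\mathcal E_{id}=A$ with ${}_A\langle a,b\rangle=ab^*$, $\langle a,b\rangle_A=a^*b$. A finite family $\xi_1,\dots,\xi_n\in\mathcal E$ is a finite basis of $\mathcal E$ if $\eta=\sum_{i=1}^n\xi_i\langle\xi_i,\eta\rangle_A$ for all $\eta\in\mathcal E$. Then every $A$-$A$-equivalence bimodule has a finite basis; for any two finite bases $\{\xi_i\}_{i=1}^n$ and $\{\zeta_k\}_{k=1}^m$ of $\mathcal E$ one has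 $$\sum_{i=1}^n\tau(\langle\xi_i,\xi_i\rangle_A)=\sum_{k=1}^m\tau(\langle\zeta_k,\zeta_k\rangle_A);$$ and there is a well-defined map $T:\mathrm{Pic}(A)\to\mathbb R_+^\times=(0,\infty)$ such that $T([\mathcal E])=\sum_{i=1}^n\tau(\langle\xi_i,\xi_i\rangle_A)$ for every equivalence bimodule $\mathcal E$ and every finite basis $\{\xi_i\}_{i=1}^n$ of $\mathcal E$. Moreover $T$ is multiplicative, $T([\mathcal E_1\otimes_A\mathcal E_2])=T([\mathcal E_1])\,T([\mathcal E_2])$, and $T([\mathcal E_{id}])=1$. -/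

import Mathlib

open scoped RightActions ComplexOrder
universe u
/-- The norm `‖x‖ = ‖⟨x, x⟩‖ ^ (1/2)` attached to an `A`-valued inner product `B = ⟨·, ·⟩`. -/
noncomputable def innerNorm {A E : Type*} [Norm A] (B : E → E → A) (x : E) : ℝ := √‖B x x‖

/-- Completeness of `E` for the norm attached to an `A`-valued inner product `B`: every Cauchy
sequence converges. -/
def IsCompleteFor {A E : Type*} [Norm A] [AddCommGroup E] (B : E → E → A) : Prop :=
  ∀ u : ℕ → E, (∀ ε > 0, ∃ N, ∀ m ≥ N, ∀ n ≥ N, innerNorm B (u m - u n) < ε) →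
    ∃ x, ∀ ε > 0, ∃ N, ∀ n ≥ N, innerNorm B (u n - x) < ε


/-- Auxiliary predicate, used only to treat left and right inner products by the same proofs.
It holds for `B = ⟨·, ·⟩_A` with `act a x = x a`, and for `B = ₐ⟨·, ·⟩` with `act a x = a* x`. -/
structure PreInner {A E : Type*} [CStarAlgebra A] [PartialOrder A] [AddCommGroup E]
    (B : E → E → A) (act : A → E → E) : Prop where
  add_right : ∀ x y z, B x (y + z) = B x y + B x z
  act_right : ∀ a x y, B x (act a y) = B x y * a
  star_apply : ∀ x y, star (B x y) = B y x
  nonneg : ∀ x, 0 ≤ B x x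

namespace PreInner
variable {A E : Type*} [CStarAlgebra A] [PartialOrder A] [AddCommGroup E]
  {B : E → E → A} {act : A → E → E}

theorem add_left (h : PreInner B act) (x y z : E) : B (x + y) z = B x z + B y z := by
  rw [← h.star_apply, h.add_right, star_add, h.star_apply, h.star_apply]

theorem act_left (h : PreInner B act) (a : A) (x y : E) : B (act a x) y = star a * B x y := by
  rw [← h.star_apply, h.act_right, star_mul, h.star_apply]

/-- `B x` as an additive map. -/
def homRight (h : PreInner B act) (x : E) : E →+ A := AddMonoidHom.mk' (B x) (h.add_right x)
/-- `B · y` as an additive map. -/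
def homLeft (h : PreInner B act) (y : E) : E →+ A :=
  AddMonoidHom.mk' (fun x => B x y) (fun x x' => h.add_left x x' y)

theorem sub_right (h : PreInner B act) (x y z : E) : B x (y - z) = B x y - B x z :=
  map_sub (h.homRight x) y z
theorem sub_left (h : PreInner B act) (x y z : E) : B (x - y) z = B x z - B y z :=
  map_sub (h.homLeft z) x y
theorem sum_right (h : PreInner B act) {ι : Type*} [Fintype ι] (x : E) (f : ι → E) :
    B x (∑ i, f i) = ∑ i, B x (f i) := map_sum (h.homRight x) f _
theorem sum_left (h : PreInner B act) {ι : Type*} [Fintype ι] (x : E) (f : ι → E) :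
    B (∑ i, f i) x = ∑ i, B (f i) x := map_sum (h.homLeft x) f _

variable [StarOrderedRing A]

theorem exists_sum_self_eq_one (h : PreInner B act)
    (hd : Dense (Submodule.span ℂ (Set.range fun p : E × E => B p.1 p.2) : Set A)) :
    ∃ (n : ℕ) (e : Fin n → E), ∑ i, B (e i) (e i) = 1 := by
  have hspan : ∀ s ∈ Submodule.span ℂ (Set.range fun p : E × E => B p.1 p.2), ∀ a : A,
      ∃ l : List (E × E), s * a = (l.map fun p => B p.1 p.2).sum := by
    intro s hs
    induction hs using Submodule.span_induction with
    | mem x hx =>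
      obtain ⟨p, rfl⟩ := hx
      intro a
      exact ⟨[(p.1, act a p.2)], by simp [h.act_right]⟩
    | zero => exact fun a => ⟨[], by simp⟩
    | add x y _ _ hx hy =>
      intro a
      obtain ⟨l, hl⟩ := hx a
      obtain ⟨m, hm⟩ := hy a
      exact ⟨l ++ m, by simp [add_mul, hl, hm]⟩
    | smul c x _ hx =>
      intro a
      obtain ⟨l, hl⟩ := hx (c • a)
      exact ⟨l, by rw [← hl]; simp⟩
  obtain ⟨s, hs, hs1⟩ := Metric.dense_iff.1 hd 1 1 one_pos
  have hu : IsUnit s := by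
    have h2 : ‖1 - s‖ < 1 := by rwa [← dist_eq_norm, dist_comm]
    have := (Units.oneSub (1 - s) h2).isUnit
    simpa using this
  obtain ⟨⟨s, t, hst, hts⟩, rfl⟩ := hu
  obtain ⟨l, hl⟩ := hspan s hs1 t
  rw [hst] at hl
  have key : ∀ l : List (E × E),
      (l.map fun p => B p.1 p.2).sum + star (l.map fun p => B p.1 p.2).sum ≤
        ((l.flatMap fun p => [p.1, p.2]).map fun z => B z z).sum := by
    intro l
    induction l with
    | nil => simp
    | cons p l ih =>
      have hp := h.nonneg (p.1 - p.2)
      rw [h.sub_right, h.sub_left, h.sub_left] at hp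
      simp only [List.map_cons, List.sum_cons, star_add, h.star_apply, List.flatMap_cons,
        List.map_append, List.sum_append, List.map_nil, List.sum_nil, add_zero]
      have hp' : B p.1 p.2 + B p.2 p.1 ≤ B p.1 p.1 + B p.2 p.2 := by
        rw [← sub_nonneg]; convert hp using 1; abel
      calc _ = (B p.1 p.2 + B p.2 p.1) + ((l.map fun p => B p.1 p.2).sum +
            star (l.map fun p => B p.1 p.2).sum) := by abel
        _ ≤ _ := add_le_add hp' ih
  have hk := key l
  rw [← hl, star_one] at hk
  set L := l.flatMap fun p => [p.1, p.2]
  set S := (L.map fun z => B z z).sum with hS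
  have h1S : (1 : A) ≤ S := le_trans (by simp) hk
  have hSp : IsStrictlyPositive S := IsStrictlyPositive.of_le (by simp) h1S
  set r : A := S ^ (-(1/2) : ℝ) with hr
  have hrs : star r = r := (CFC.rpow_nonneg (a := S) (y := -(1/2))).isSelfAdjoint
  have hone : r * S * r = 1 := by
    exact CFC.conjugate_rpow_neg_one_half S hSp
  refine ⟨L.length, fun i => act r L[i], ?_⟩
  have : S = ∑ i : Fin L.length, B L[i] L[i] := by
    rw [hS]
    conv_lhs => rw [← List.ofFn_get L, List.map_ofFn, List.sum_ofFn]
    rfl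
  simp only [h.act_left, h.act_right, hrs]
  rw [← hone, this, Finset.mul_sum, Finset.sum_mul]
  simp [mul_assoc]

theorem isCompleteFor_of_frame (h : PreInner B act)
    {ι : Type*} [Fintype ι] (z : ι → E)
    (hz : ∀ v, v = ∑ i, act (B (z i) v) (z i)) : IsCompleteFor B := by
  have hself : ∀ v, B v v = ∑ i, star (B (z i) v) * B (z i) v := by
    intro v
    conv_lhs => rw [hz v, h.sum_left]
    have : ∑ i, act (B (z i) v) (z i) = v := (hz v).symm
    simp [h.act_left, this]
  have hle : ∀ i v, ‖B (z i) v‖ ≤ innerNorm B v := by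
    intro i v
    apply Real.le_sqrt_of_sq_le
    rw [sq, ← CStarRing.norm_star_mul_self, hself]
    exact CStarAlgebra.norm_le_norm_of_nonneg_of_le (star_mul_self_nonneg _)
      (Finset.single_le_sum (f := fun i => star (B (z i) v) * B (z i) v)
        (fun i _ => star_mul_self_nonneg _) (Finset.mem_univ i))
  intro u hu
  have hc : ∀ i, ∃ a, Filter.Tendsto (fun n => B (z i) (u n)) Filter.atTop (nhds a) := by
    intro i
    apply cauchySeq_tendsto_of_complete
    rw [Metric.cauchySeq_iff]
    intro ε hε
    obtain ⟨N, hN⟩ := hu ε hε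
    refine ⟨N, fun m hm n hn => ?_⟩
    rw [dist_eq_norm, ← h.sub_right]
    exact (hle i _).trans_lt (hN m hm n hn)
  choose a ha using hc
  refine ⟨∑ i, act (a i) (z i), ?_⟩
  set x := ∑ i, act (a i) (z i) with hx
  have hj : ∀ j, Filter.Tendsto (fun n => B (z j) (u n - x)) Filter.atTop (nhds 0) := by
    intro j
    have e1 : ∀ n, B (z j) (u n - x) = ∑ i, B (z j) (z i) * (B (z i) (u n) - a i) := by
      intro n
      conv_lhs => rw [hz (u n)]
      simp only [hx, h.sub_right, h.sum_right, h.act_right, mul_sub, Finset.sum_sub_distrib]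
    simp only [e1]
    have : (0 : A) = ∑ i, B (z j) (z i) * (a i - a i) := by simp
    rw [this]
    exact tendsto_finsetSum _ fun i _ => ((ha i).sub_const _).const_mul _
  have hlim : Filter.Tendsto (fun n => innerNorm B (u n - x)) Filter.atTop (nhds 0) := by
    have : (0 : ℝ) = √‖∑ i : ι, star (0 : A) * 0‖ := by simp
    rw [this]
    simp only [innerNorm, hself]
    exact (tendsto_finsetSum _ fun i _ => ((hj i).star.mul (hj i))).norm.sqrt
  intro ε hε
  obtain ⟨N, hN⟩ := Filter.eventually_atTop.1 (hlim.eventually (gt_mem_nhds hε))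
  exact ⟨N, hN⟩

end PreInner

/-- An `A`-`A`-equivalence bimodule over a unital C⋆-algebra `A`: a complex vector space with
commuting left and right `A`-actions (the right action `x <• a` is encoded as an action of `Aᵐᵒᵖ`),
which is a full left Hilbert `A`-module for `innerL` (linear in the first variable) and a full right
Hilbert `A`-module for `innerR` (linear in the second variable), such that
`innerL x y • z = x <• innerR y z`. -/
structure EquivalenceBimodule (A : Type u) [CStarAlgebra A] [PartialOrder A]
    [StarOrderedRing A] where
  carrier : Type u
  [addCommGroup : AddCommGroup carrier]
  [complexModule : Module ℂ carrier]
  [leftModule : Module A carrier]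
  [rightModule : Module Aᵐᵒᵖ carrier]
  [smulCommClass : SMulCommClass A Aᵐᵒᵖ carrier]
  [leftTower : IsScalarTower ℂ A carrier]
  [rightTower : IsScalarTower ℂ Aᵐᵒᵖ carrier]
  /-- the right `A`-valued inner product `⟨x, y⟩_A` -/
  innerR : carrier → carrier → A
  innerR_add_right : ∀ x y z, innerR x (y + z) = innerR x y + innerR x z
  innerR_smul_right : ∀ (c : ℂ) x y, innerR x (c • y) = c • innerR x y
  innerR_act_right : ∀ (a : A) x y, innerR x (y <• a) = innerR x y * a
  star_innerR : ∀ x y, star (innerR x y) = innerR y x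
  innerR_self_nonneg : ∀ x, 0 ≤ innerR x x
  innerR_definite : ∀ x, innerR x x = 0 → x = 0
  completeR : IsCompleteFor innerR
  fullR : Dense (Submodule.span ℂ (Set.range fun p : carrier × carrier => innerR p.1 p.2) : Set A)
  /-- the left `A`-valued inner product `ₐ⟨x, y⟩` -/
  innerL : carrier → carrier → A
  innerL_add_left : ∀ x y z, innerL (x + y) z = innerL x z + innerL y z
  innerL_smul_left : ∀ (c : ℂ) x y, innerL (c • x) y = c • innerL x y
  innerL_act_left : ∀ (a : A) x y, innerL (a •> x) y = a * innerL x y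
  star_innerL : ∀ x y, star (innerL x y) = innerL y x
  innerL_self_nonneg : ∀ x, 0 ≤ innerL x x
  innerL_definite : ∀ x, innerL x x = 0 → x = 0
  completeL : IsCompleteFor innerL
  fullL : Dense (Submodule.span ℂ (Set.range fun p : carrier × carrier => innerL p.1 p.2) : Set A)
  innerL_act_eq : ∀ x y z, innerL x y •> z = x <• innerR y z

namespace EquivalenceBimodule

attribute [instance] addCommGroup complexModule leftModule rightModule smulCommClass leftTower
  rightTower

theorem dense_star_mul (A : Type u) [CStarAlgebra A] :
    Dense (Submodule.span ℂ (Set.range fun p : A × A => star p.1 * p.2) : Set A) := fun a =>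
  subset_closure (Submodule.subset_span ⟨(1, a), by simp⟩)

theorem dense_mul_star (A : Type u) [CStarAlgebra A] :
    Dense (Submodule.span ℂ (Set.range fun p : A × A => p.1 * star p.2) : Set A) := fun a =>
  subset_closure (Submodule.subset_span ⟨(a, 1), by simp⟩)

variable {A : Type u} [CStarAlgebra A] [PartialOrder A] [StarOrderedRing A]

/-- A family `ξ₁, …, ξₙ` is a finite basis of `E` if `η = ∑ᵢ ξᵢ ⟨ξᵢ, η⟩_A` for all `η`. -/
def IsFiniteBasis (E : EquivalenceBimodule A) {n : ℕ} (ξ : Fin n → E.carrier) : Prop :=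
  ∀ η : E.carrier, η = ∑ i, ξ i <• E.innerR (ξ i) η

theorem preInnerR (E : EquivalenceBimodule A) : PreInner E.innerR (fun a x => x <• a) :=
  ⟨E.innerR_add_right, E.innerR_act_right, E.star_innerR, E.innerR_self_nonneg⟩

theorem preInnerL (E : EquivalenceBimodule A) : PreInner E.innerL (fun a x => star a •> x) where
  add_right x y z := by
    rw [← E.star_innerL, E.innerL_add_left, star_add, E.star_innerL, E.star_innerL]
  act_right a x y := by
    rw [← E.star_innerL, E.innerL_act_left, star_mul, E.star_innerL, star_star]
  star_apply := E.star_innerL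
  nonneg := E.innerL_self_nonneg

theorem innerR_add_left (E : EquivalenceBimodule A) (x y z : E.carrier) :
    E.innerR (x + y) z = E.innerR x z + E.innerR y z := E.preInnerR.add_left x y z

theorem innerL_add_right (E : EquivalenceBimodule A) (x y z : E.carrier) :
    E.innerL x (y + z) = E.innerL x y + E.innerL x z := E.preInnerL.add_right x y z

theorem innerR_act_left (E : EquivalenceBimodule A) (a : A) (x y : E.carrier) :
    E.innerR (x <• a) y = star a * E.innerR x y := E.preInnerR.act_left a x y

theorem innerL_act_right (E : EquivalenceBimodule A) (a : A) (x y : E.carrier) :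
    E.innerL x (a •> y) = E.innerL x y * star a := by
  simpa using E.preInnerL.act_right (star a) x y

theorem exists_innerR_eq_one (E : EquivalenceBimodule A) :
    ∃ (n : ℕ) (e : Fin n → E.carrier), ∑ i, E.innerR (e i) (e i) = 1 :=
  E.preInnerR.exists_sum_self_eq_one E.fullR

theorem exists_innerL_eq_one (E : EquivalenceBimodule A) :
    ∃ (n : ℕ) (e : Fin n → E.carrier), ∑ i, E.innerL (e i) (e i) = 1 :=
  E.preInnerL.exists_sum_self_eq_one E.fullL

theorem isFiniteBasis_of_innerL (E : EquivalenceBimodule A) {n : ℕ} {e : Fin n → E.carrier}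
    (h : ∑ i, E.innerL (e i) (e i) = 1) : E.IsFiniteBasis e := fun η => by
  simp only [← E.innerL_act_eq, ← Finset.sum_smul, h, one_smul]

/-- The left action is by adjointable operators for the right inner product. -/
theorem innerR_leftAct (E : EquivalenceBimodule A) (a : A) (x y : E.carrier) :
    E.innerR (a •> x) y = E.innerR x (star a •> y) := by
  obtain ⟨n, e, he⟩ := E.exists_innerL_eq_one
  have h1 : a •> x = ∑ i, (a •> e i) <• E.innerR (e i) x := by
    simp only [← E.innerL_act_eq, ← Finset.sum_smul, E.innerL_act_left, ← Finset.mul_sum, he,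
      mul_one]
  have h2 : star a •> y = ∑ i, e i <• E.innerR (a •> e i) y := by
    simp only [← E.innerL_act_eq, ← Finset.sum_smul, E.innerL_act_right, ← Finset.sum_mul, he,
      one_mul]
  rw [h1, h2, E.preInnerR.sum_left, E.preInnerR.sum_right]
  simp only [E.innerR_act_left, E.innerR_act_right, E.star_innerR]

/-- The right action is by adjointable operators for the left inner product. -/
theorem innerL_rightAct (E : EquivalenceBimodule A) (a : A) (x y : E.carrier) :
    E.innerL (x <• a) y = E.innerL x (y <• star a) := by
  obtain ⟨n, e, he⟩ := E.exists_innerR_eq_one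
  have h1 : x <• a = ∑ i, E.innerL x (e i <• star a) •> e i := by
    simp only [E.innerL_act_eq, ← Finset.sum_smul, E.innerR_act_left, star_star,
      ← Finset.op_sum, ← Finset.mul_sum, he, mul_one]
  have h2 : y <• star a = ∑ i, E.innerL y (e i) •> (e i <• star a) := by
    simp only [E.innerL_act_eq, ← Finset.sum_smul, E.innerR_act_right,
      ← Finset.op_sum, ← Finset.sum_mul, he, one_mul]
  rw [h1, h2, E.preInnerL.sum_left, E.preInnerL.sum_right]
  simp only [E.innerL_act_left, E.innerL_act_right, E.star_innerL]

/-! ### The identity bimodule -/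

variable (A) in
theorem complete_star_mul : IsCompleteFor (fun a b : A => star a * b) := by
  have h : PreInner (fun a b : A => star a * b) (fun a x => x * a) :=
    ⟨fun x y z => mul_add _ _ _, fun a x y => (mul_assoc _ _ _).symm, fun x y => by simp,
      fun x => star_mul_self_nonneg x⟩
  exact h.isCompleteFor_of_frame (fun _ : Unit => (1 : A)) (by simp)

variable (A) in
theorem complete_mul_star : IsCompleteFor (fun a b : A => a * star b) := by
  have h : PreInner (fun a b : A => a * star b) (fun a x => star a * x) :=
    ⟨fun x y z => by simp [mul_add], fun a x y => by simp [mul_assoc], fun x y => by simp,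
      fun x => mul_star_self_nonneg x⟩
  exact h.isCompleteFor_of_frame (fun _ : Unit => (1 : A)) (by simp)

variable (A) in
/-- The bimodule `A` with `ₐ⟨a, b⟩ = a b*` and `⟨a, b⟩_A = a* b`. -/
noncomputable def identity : EquivalenceBimodule A where
  carrier := A
  innerR a b := star a * b
  innerR_add_right x y z := mul_add _ _ _
  innerR_smul_right c x y := mul_smul_comm _ _ _
  innerR_act_right a x y := by simp [mul_assoc]
  star_innerR x y := by simp
  innerR_self_nonneg x := star_mul_self_nonneg x
  innerR_definite x h := by simpa using h
  completeR := complete_star_mul A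
  fullR := dense_star_mul A
  innerL a b := a * star b
  innerL_add_left x y z := add_mul _ _ _
  innerL_smul_left c x y := smul_mul_assoc _ _ _
  innerL_act_left a x y := by simp [mul_assoc]
  star_innerL x y := by simp
  innerL_self_nonneg x := mul_star_self_nonneg x
  innerL_definite x h := by simpa using h
  completeL := complete_mul_star A
  fullL := dense_mul_star A
  innerL_act_eq x y z := by simp [mul_assoc]

/-! ### The interior tensor product -/

section Tensor

open TensorProduct

variable (E F : EquivalenceBimodule A)

/-- The relations `x a ⊗ y = x ⊗ a y`. -/
def balancedRelations : Submodule ℂ (E.carrier ⊗[ℂ] F.carrier) :=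
  Submodule.span ℂ {t | ∃ (x : E.carrier) (a : A) (y : F.carrier),
    t = (x <• a) ⊗ₜ[ℂ] y - x ⊗ₜ[ℂ] (a •> y)}

/-- The `A`-balanced algebraic tensor product `E ⊗_A F`. -/
def TensorCarrier : Type u := (E.carrier ⊗[ℂ] F.carrier) ⧸ balancedRelations E F

noncomputable instance : AddCommGroup (TensorCarrier E F) :=
  inferInstanceAs (AddCommGroup ((E.carrier ⊗[ℂ] F.carrier) ⧸ balancedRelations E F))

noncomputable instance : Module ℂ (TensorCarrier E F) :=
  inferInstanceAs (Module ℂ ((E.carrier ⊗[ℂ] F.carrier) ⧸ balancedRelations E F))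

namespace TensorCarrier

variable {E F}

/-- The class of the elementary tensor `x ⊗ y`. -/
def tmul (x : E.carrier) (y : F.carrier) : TensorCarrier E F :=
  Submodule.Quotient.mk (p := balancedRelations E F) (x ⊗ₜ[ℂ] y)

theorem add_tmul (x x' : E.carrier) (y : F.carrier) :
    tmul (x + x') y = tmul x y + tmul x' y :=
  congrArg (Submodule.Quotient.mk (p := balancedRelations E F)) (TensorProduct.add_tmul x x' y)

theorem tmul_add (x : E.carrier) (y y' : F.carrier) :
    tmul x (y + y') = tmul x y + tmul x y' :=
  congrArg (Submodule.Quotient.mk (p := balancedRelations E F)) (TensorProduct.tmul_add x y y')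

theorem smul_tmul (c : ℂ) (x : E.carrier) (y : F.carrier) :
    c • tmul x y = tmul (c • x) y := rfl

theorem act_tmul (x : E.carrier) (a : A) (y : F.carrier) :
    tmul (x <• a) y = tmul x (a •> y) :=
  (Submodule.Quotient.eq _).2 (Submodule.subset_span ⟨x, a, y, rfl⟩)

/-- `tmul` as a biadditive map. -/
noncomputable def tmulHom : E.carrier →+ F.carrier →+ TensorCarrier E F :=
  AddMonoidHom.mk' (fun x => AddMonoidHom.mk' (tmul x) (tmul_add x))
    fun x x' => AddMonoidHom.ext fun y => add_tmul x x' y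

theorem zero_tmul (y : F.carrier) : tmul (0 : E.carrier) y = 0 := map_zero (tmulHom.flip y)

theorem tmul_zero (x : E.carrier) : tmul x (0 : F.carrier) = 0 := map_zero (tmulHom x)

theorem sum_tmul {ι : Type*} [Fintype ι] (f : ι → E.carrier) (y : F.carrier) :
    tmul (∑ i, f i) y = ∑ i, tmul (f i) y := by
  have := DFunLike.congr_fun (map_sum (tmulHom (E := E) (F := F)) f Finset.univ) y
  rwa [AddMonoidHom.finsetSum_apply] at this

theorem tmul_sum {ι : Type*} [Fintype ι] (x : E.carrier) (f : ι → F.carrier) :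
    tmul x (∑ i, f i) = ∑ i, tmul x (f i) :=
  map_sum (tmulHom (E := E) (F := F) x) f Finset.univ

@[elab_as_elim]
theorem induction {p : TensorCarrier E F → Prop} (tmul : ∀ x y, p (tmul x y))
    (add : ∀ v w, p v → p w → p (v + w)) (v : TensorCarrier E F) : p v := by
  obtain ⟨t, rfl⟩ := Submodule.Quotient.mk_surjective _ v
  induction t using TensorProduct.induction_on with
  | zero => simpa [TensorCarrier.tmul] using tmul 0 0
  | tmul x y => exact tmul x y
  | add x y hx hy => exact add _ _ hx hy

section lift

variable {M : Type*} [AddCommGroup M]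

/-- The additive map on `E ⊗_A F` induced by a biadditive balanced map. -/
noncomputable def liftHom (f : E.carrier → F.carrier → M)
    (hl : ∀ x x' y, f (x + x') y = f x y + f x' y) (hr : ∀ x y y', f x (y + y') = f x y + f x y')
    (hb : ∀ (x : E.carrier) (a : A) (y : F.carrier), f (x <• a) y = f x (a •> y)) : TensorCarrier E F →+ M :=
  QuotientAddGroup.lift (balancedRelations E F).toAddSubgroup
    (TensorProduct.liftAddHom (R := ℂ)
      (AddMonoidHom.mk' (fun x => AddMonoidHom.mk' (f x) (hr x))
        fun x x' => AddMonoidHom.ext fun y => hl x x' y)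
      fun c x y => by
        have h := hb x (c • (1 : A)) y
        simpa using h) <| by
    intro t ht
    have key : ∀ c : ℂ, TensorProduct.liftAddHom (R := ℂ)
      (AddMonoidHom.mk' (fun x => AddMonoidHom.mk' (f x) (hr x))
        fun x x' => AddMonoidHom.ext fun y => hl x x' y)
      (fun c x y => by
        have h := hb x (c • (1 : A)) y
        simpa using h) (c • t) = 0 := by
      change t ∈ balancedRelations E F at ht
      induction ht using Submodule.span_induction with
      | mem t h =>
        obtain ⟨x, a, y, rfl⟩ := h
        intro c
        rw [smul_sub, map_sub, TensorProduct.smul_tmul', TensorProduct.smul_tmul',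
          TensorProduct.liftAddHom_tmul, TensorProduct.liftAddHom_tmul, sub_eq_zero,
          smul_comm c (MulOpposite.op a) x]
        exact hb _ _ _
      | zero => intro c; rw [smul_zero, map_zero]
      | add s t _ _ hs ht => intro c; rw [smul_add, map_add, hs, ht, add_zero]
      | smul d t _ ht => intro c; rw [smul_smul, ht]
    simpa using key 1

@[simp]
theorem liftHom_tmul (f : E.carrier → F.carrier → M) (hl hr hb) (x : E.carrier) (y : F.carrier) :
    liftHom f hl hr hb (tmul x y) = f x y := rfl

end lift

theorem hom_ext {M : Type*} [AddCommGroup M] {f g : TensorCarrier E F →+ M}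
    (h : ∀ x y, f (tmul x y) = g (tmul x y)) (v : TensorCarrier E F) : f v = g v := by
  induction v using TensorCarrier.induction with
  | tmul x y => exact h x y
  | add v w hv hw => rw [map_add, map_add, hv, hw]

/-- The left action `a (x ⊗ y) = a x ⊗ y`. -/
noncomputable def leftAct (a : A) : TensorCarrier E F →+ TensorCarrier E F :=
  liftHom (fun x y => tmul (a •> x) y) (fun x x' y => by rw [smul_add, add_tmul])
    (fun x y y' => tmul_add _ _ _) (fun x b y => by rw [smul_comm, act_tmul])

/-- The right action `(x ⊗ y) a = x ⊗ y a`. -/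
noncomputable def rightAct (a : Aᵐᵒᵖ) : TensorCarrier E F →+ TensorCarrier E F :=
  liftHom (fun x y => tmul x (a • y)) (fun x x' y => add_tmul _ _ _)
    (fun x y y' => by rw [smul_add, tmul_add]) (fun x b y => by rw [act_tmul, smul_comm])

noncomputable instance : Module A (TensorCarrier E F) where
  smul a v := leftAct a v
  one_smul v := hom_ext (f := leftAct 1) (g := AddMonoidHom.id _)
    (fun x y => by simp [leftAct]) v
  mul_smul a b v := hom_ext (f := leftAct (a * b)) (g := (leftAct a).comp (leftAct b))
    (fun x y => by simp [leftAct, mul_smul]) v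
  smul_zero a := map_zero (leftAct a)
  smul_add a := map_add (leftAct a)
  add_smul a b v := hom_ext (f := leftAct (a + b)) (g := leftAct a + leftAct b)
    (fun x y => by simp [leftAct, add_smul, add_tmul]) v
  zero_smul v := hom_ext (f := leftAct 0) (g := 0)
    (fun x y => by simp [leftAct, zero_tmul]) v

noncomputable instance : Module Aᵐᵒᵖ (TensorCarrier E F) where
  smul a v := rightAct a v
  one_smul v := hom_ext (f := rightAct 1) (g := AddMonoidHom.id _)
    (fun x y => by simp [rightAct]) v
  mul_smul a b v := hom_ext (f := rightAct (a * b)) (g := (rightAct a).comp (rightAct b))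
    (fun x y => by simp [rightAct, mul_smul]) v
  smul_zero a := map_zero (rightAct a)
  smul_add a := map_add (rightAct a)
  add_smul a b v := hom_ext (f := rightAct (a + b)) (g := rightAct a + rightAct b)
    (fun x y => by simp [rightAct, add_smul, tmul_add]) v
  zero_smul v := hom_ext (f := rightAct 0) (g := 0)
    (fun x y => by simp [rightAct, tmul_zero]) v

theorem leftAct_tmul (a : A) (x : E.carrier) (y : F.carrier) :
    a •> tmul x y = tmul (a •> x) y := rfl

theorem rightAct_tmul (a : A) (x : E.carrier) (y : F.carrier) :
    tmul x y <• a = tmul x (y <• a) := rfl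

theorem smul_tmul_right (c : ℂ) (x : E.carrier) (y : F.carrier) :
    c • tmul x y = tmul x (c • y) := by
  have h := act_tmul x (c • (1 : A)) y
  rw [smul_tmul]
  simpa using h

instance : SMulCommClass A Aᵐᵒᵖ (TensorCarrier E F) where
  smul_comm a b v := by
    induction v using TensorCarrier.induction with
    | tmul x y => rfl
    | add v w hv hw => simp only [smul_add, hv, hw]

instance : IsScalarTower ℂ A (TensorCarrier E F) where
  smul_assoc c a v := by
    induction v using TensorCarrier.induction with
    | tmul x y => rw [leftAct_tmul, leftAct_tmul, smul_tmul, smul_assoc]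
    | add v w hv hw => simp only [smul_add, hv, hw]

instance : IsScalarTower ℂ Aᵐᵒᵖ (TensorCarrier E F) where
  smul_assoc c a v := by
    induction v using TensorCarrier.induction with
    | tmul x y =>
      have h1 : ∀ b : Aᵐᵒᵖ, b • tmul x y = tmul x (b • y) := fun _ => rfl
      rw [h1, h1, smul_tmul_right, smul_assoc]
    | add v w hv hw => simp only [smul_add, hv, hw]

/-- The right inner product `⟨x ⊗ y, x' ⊗ y'⟩_A = ⟨y, ⟨x, x'⟩_A y'⟩_A`. -/
noncomputable def innerRHom : TensorCarrier E F →+ TensorCarrier E F →+ A :=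
  liftHom (fun x y => liftHom (fun x' y' => F.innerR y (E.innerR x x' •> y'))
      (fun x' x'' y' => by rw [E.innerR_add_right, add_smul, F.innerR_add_right])
      (fun x' y' y'' => by rw [smul_add, F.innerR_add_right])
      (fun x' a y' => by rw [E.innerR_act_right, mul_smul]))
    (fun x x' y => AddMonoidHom.ext <| hom_ext fun x'' y' => by
      simp [E.innerR_add_left, add_smul, F.innerR_add_right])
    (fun x y y' => AddMonoidHom.ext <| hom_ext fun x'' y'' => by
      simp [F.innerR_add_left])
    (fun x a y => AddMonoidHom.ext <| hom_ext fun x'' y'' => by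
      simp [E.innerR_act_left, mul_smul, F.innerR_leftAct])

/-- The left inner product `ₐ⟨x ⊗ y, x' ⊗ y'⟩ = ₐ⟨x ₐ⟨y, y'⟩, x'⟩`. -/
noncomputable def innerLHom : TensorCarrier E F →+ TensorCarrier E F →+ A :=
  liftHom (fun x y => liftHom (fun x' y' => E.innerL (x <• F.innerL y y') x')
      (fun x' x'' y' => by rw [E.innerL_add_right])
      (fun x' y' y'' => by
        rw [F.innerL_add_right, MulOpposite.op_add, add_smul, E.innerL_add_left])
      (fun x' a y' => by
        rw [F.innerL_act_right, MulOpposite.op_mul, mul_smul, E.innerL_rightAct (star a), star_star]))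
    (fun x x' y => AddMonoidHom.ext <| hom_ext fun x'' y' => by
      simp [E.innerL_add_left])
    (fun x y y' => AddMonoidHom.ext <| hom_ext fun x'' y'' => by
      simp [F.innerL_add_left, add_smul, E.innerL_add_left])
    (fun x a y => AddMonoidHom.ext <| hom_ext fun x'' y'' => by
      simp [F.innerL_act_left, mul_smul])

@[simp]
theorem innerRHom_tmul (x x' : E.carrier) (y y' : F.carrier) :
    innerRHom (tmul x y) (tmul x' y') = F.innerR y (E.innerR x x' •> y') := rfl

@[simp]
theorem innerLHom_tmul (x x' : E.carrier) (y y' : F.carrier) :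
    innerLHom (tmul x y) (tmul x' y') = E.innerL (x <• F.innerL y y') x' := rfl

theorem star_innerRHom (v w : TensorCarrier E F) : star (innerRHom v w) = innerRHom w v := by
  induction v using TensorCarrier.induction with
  | tmul x y =>
    induction w using TensorCarrier.induction with
    | tmul x' y' => rw [innerRHom_tmul, innerRHom_tmul, F.star_innerR, F.innerR_leftAct, E.star_innerR]
    | add v w hv hw => simp only [map_add, AddMonoidHom.add_apply, star_add, hv, hw]
  | add v v' hv hv' => simp only [map_add, AddMonoidHom.add_apply, star_add, hv, hv']

theorem star_innerLHom (v w : TensorCarrier E F) : star (innerLHom v w) = innerLHom w v := by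
  induction v using TensorCarrier.induction with
  | tmul x y =>
    induction w using TensorCarrier.induction with
    | tmul x' y' =>
      rw [innerLHom_tmul, innerLHom_tmul, E.star_innerL, ← F.star_innerL y, E.innerL_rightAct,
        star_star]
    | add v w hv hw => simp only [map_add, AddMonoidHom.add_apply, star_add, hv, hw]
  | add v v' hv hv' => simp only [map_add, AddMonoidHom.add_apply, star_add, hv, hv']

/-- The map `x' ⊗ y ↦ ⟨x, x'⟩_A y`. -/
noncomputable def contractR (x : E.carrier) : TensorCarrier E F →+ F.carrier :=
  liftHom (fun x' y => E.innerR x x' •> y)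
    (fun x' x'' y => by rw [E.innerR_add_right, add_smul]) (fun x' y y' => smul_add _ _ _)
    (fun x' a y => by rw [E.innerR_act_right, mul_smul])

/-- The map `x ⊗ y' ↦ x ₐ⟨y', y⟩`. -/
noncomputable def contractL (y : F.carrier) : TensorCarrier E F →+ E.carrier :=
  liftHom (fun x y' => x <• F.innerL y' y)
    (fun x' x'' y => smul_add _ _ _)
    (fun x' y y' => by rw [F.innerL_add_left, MulOpposite.op_add, add_smul])
    (fun x' a y => by rw [F.innerL_act_left, MulOpposite.op_mul, mul_smul])

section frame

variable {n : ℕ}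

theorem eq_sum_contractR {e : Fin n → E.carrier} (he : E.IsFiniteBasis e) (v : TensorCarrier E F) :
    v = ∑ i, tmul (e i) (contractR (e i) v) := by
  induction v using TensorCarrier.induction with
  | tmul x y =>
    conv_lhs => rw [he x, sum_tmul]
    simp only [act_tmul, contractR, liftHom_tmul]
  | add v w hv hw =>
    conv_lhs => rw [hv, hw]
    simp only [map_add, tmul_add, Finset.sum_add_distrib]

theorem eq_sum_contractL {e : Fin n → F.carrier}
    (he : ∀ y, y = ∑ i, F.innerL y (e i) •> e i) (v : TensorCarrier E F) :
    v = ∑ i, tmul (contractL (e i) v) (e i) := by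
  induction v using TensorCarrier.induction with
  | tmul x y =>
    conv_lhs => rw [he y, tmul_sum]
    simp only [act_tmul, contractL, liftHom_tmul]
  | add v w hv hw =>
    conv_lhs => rw [hv, hw]
    simp only [map_add, add_tmul, Finset.sum_add_distrib]

theorem innerRHom_tmul_left (x : E.carrier) (y : F.carrier) (w : TensorCarrier E F) :
    innerRHom (tmul x y) w = F.innerR y (contractR x w) := by
  induction w using TensorCarrier.induction with
  | tmul x' y' => rfl
  | add v w hv hw => simp only [map_add, F.innerR_add_right, hv, hw]

theorem innerLHom_tmul_right (x : E.carrier) (y : F.carrier) (w : TensorCarrier E F) :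
    innerLHom w (tmul x y) = E.innerL (contractL y w) x := by
  induction w using TensorCarrier.induction with
  | tmul x' y' => rfl
  | add v w hv hw => simp only [map_add, AddMonoidHom.add_apply, E.innerL_add_left, hv, hw]

theorem innerRHom_self {e : Fin n → E.carrier} (he : E.IsFiniteBasis e) (v : TensorCarrier E F) :
    innerRHom v v = ∑ i, F.innerR (contractR (e i) v) (contractR (e i) v) := by
  conv_lhs => arg 1; rw [eq_sum_contractR he v]
  rw [map_sum, AddMonoidHom.finsetSum_apply]
  simp only [innerRHom_tmul_left]

theorem innerLHom_self {e : Fin n → F.carrier}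
    (he : ∀ y, y = ∑ i, F.innerL y (e i) •> e i) (v : TensorCarrier E F) :
    innerLHom v v = ∑ i, E.innerL (contractL (e i) v) (contractL (e i) v) := by
  conv_lhs => arg 2; rw [eq_sum_contractL he v]
  rw [map_sum]
  simp only [innerLHom_tmul_right]

end frame

theorem exists_finiteBasis (E : EquivalenceBimodule A) :
    ∃ (n : ℕ) (e : Fin n → E.carrier), E.IsFiniteBasis e := by
  obtain ⟨n, e, he⟩ := E.exists_innerL_eq_one
  exact ⟨n, e, E.isFiniteBasis_of_innerL he⟩

theorem exists_leftFrame (E : EquivalenceBimodule A) :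
    ∃ (n : ℕ) (e : Fin n → E.carrier), ∀ y, y = ∑ i, E.innerL y (e i) •> e i := by
  obtain ⟨n, e, he⟩ := E.exists_innerR_eq_one
  refine ⟨n, e, fun y => ?_⟩
  simp only [E.innerL_act_eq, ← Finset.sum_smul, ← Finset.op_sum, he, MulOpposite.op_one, one_smul]

theorem innerRHom_self_nonneg (v : TensorCarrier E F) : 0 ≤ innerRHom v v := by
  obtain ⟨n, e, he⟩ := exists_finiteBasis E
  rw [innerRHom_self he]
  exact Finset.sum_nonneg fun i _ => F.innerR_self_nonneg _

theorem innerLHom_self_nonneg (v : TensorCarrier E F) : 0 ≤ innerLHom v v := by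
  obtain ⟨n, e, he⟩ := exists_leftFrame F
  rw [innerLHom_self he]
  exact Finset.sum_nonneg fun i _ => E.innerL_self_nonneg _

theorem innerRHom_definite (v : TensorCarrier E F) (h : innerRHom v v = 0) : v = 0 := by
  obtain ⟨n, e, he⟩ := exists_finiteBasis E
  rw [innerRHom_self he, Finset.sum_eq_zero_iff_of_nonneg fun i _ => F.innerR_self_nonneg _] at h
  rw [eq_sum_contractR he v]
  exact Finset.sum_eq_zero fun i hi => by rw [F.innerR_definite _ (h i hi), tmul_zero]

theorem innerLHom_definite (v : TensorCarrier E F) (h : innerLHom v v = 0) : v = 0 := by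
  obtain ⟨n, e, he⟩ := exists_leftFrame F
  rw [innerLHom_self he, Finset.sum_eq_zero_iff_of_nonneg fun i _ => E.innerL_self_nonneg _] at h
  rw [eq_sum_contractL he v]
  exact Finset.sum_eq_zero fun i hi => by rw [E.innerL_definite _ (h i hi), zero_tmul]

theorem innerRHom_act (a : A) (v w : TensorCarrier E F) :
    innerRHom v (w <• a) = innerRHom v w * a := by
  induction v using TensorCarrier.induction with
  | tmul x y =>
    induction w using TensorCarrier.induction with
    | tmul x' y' =>
      rw [rightAct_tmul, innerRHom_tmul, innerRHom_tmul, smul_comm, F.innerR_act_right]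
    | add v w hv hw => rw [smul_add, map_add, map_add, add_mul, hv, hw]
  | add v v' hv hv' => rw [map_add, AddMonoidHom.add_apply, AddMonoidHom.add_apply, add_mul, hv, hv']

theorem innerLHom_act (a : A) (v w : TensorCarrier E F) :
    innerLHom (a •> v) w = a * innerLHom v w := by
  induction v using TensorCarrier.induction with
  | tmul x y =>
    induction w using TensorCarrier.induction with
    | tmul x' y' =>
      rw [leftAct_tmul, innerLHom_tmul, innerLHom_tmul, ← smul_comm, E.innerL_act_left]
    | add v w hv hw => rw [map_add, map_add, mul_add, hv, hw]
  | add v v' hv hv' => rw [smul_add, map_add, map_add, AddMonoidHom.add_apply,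
      AddMonoidHom.add_apply, mul_add, hv, hv']

theorem innerRHom_smul (c : ℂ) (v w : TensorCarrier E F) :
    innerRHom v (c • w) = c • innerRHom v w := by
  have h : c • w = w <• (c • (1 : A)) := by simp
  rw [h, innerRHom_act]; simp

theorem innerLHom_smul (c : ℂ) (v w : TensorCarrier E F) :
    innerLHom (c • v) w = c • innerLHom v w := by
  have h : c • v = (c • (1 : A)) •> v := by simp
  rw [h, innerLHom_act]; simp

theorem innerLHom_act_eq (u v w : TensorCarrier E F) :
    innerLHom u v •> w = u <• innerRHom v w := by
  induction u using TensorCarrier.induction with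
  | tmul x y =>
    induction v using TensorCarrier.induction with
    | tmul x' y' =>
      induction w using TensorCarrier.induction with
      | tmul x'' y'' =>
        rw [innerLHom_tmul, innerRHom_tmul, leftAct_tmul, rightAct_tmul, E.innerL_act_eq,
          ← F.innerL_act_eq, ← mul_smul, ← MulOpposite.op_mul, act_tmul, mul_smul]
      | add v w hv hw => rw [smul_add, map_add, MulOpposite.op_add, add_smul, hv, hw]
    | add v v' hv hv' =>
      rw [map_add, map_add, AddMonoidHom.add_apply, MulOpposite.op_add, add_smul, add_smul, hv, hv']
  | add u u' hu hu' => rw [map_add, AddMonoidHom.add_apply, add_smul, smul_add, hu, hu']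

theorem preInnerR : PreInner (fun v w : TensorCarrier E F => innerRHom v w)
    (fun a v => v <• a) where
  add_right _ _ _ := map_add _ _ _
  act_right a v w := innerRHom_act a v w
  star_apply := star_innerRHom
  nonneg := innerRHom_self_nonneg

theorem preInnerL : PreInner (fun v w : TensorCarrier E F => innerLHom v w)
    (fun a v => star a •> v) where
  add_right _ _ _ := map_add _ _ _
  act_right a v w := by rw [← star_innerLHom, innerLHom_act, star_mul, star_innerLHom, star_star]
  star_apply := star_innerLHom
  nonneg := innerLHom_self_nonneg

theorem completeR : IsCompleteFor (fun v w : TensorCarrier E F => innerRHom v w) := by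
  obtain ⟨n, e, he⟩ := exists_finiteBasis E
  obtain ⟨m, f, hf⟩ := exists_finiteBasis F
  refine preInnerR.isCompleteFor_of_frame (fun p : Fin n × Fin m => tmul (e p.1) (f p.2))
    fun v => ?_
  conv_lhs => rw [eq_sum_contractR he v]
  rw [Fintype.sum_prod_type]
  refine Finset.sum_congr rfl fun i _ => ?_
  conv_lhs => rw [hf (contractR (e i) v), tmul_sum]
  simp only [innerRHom_tmul_left, rightAct_tmul]

theorem completeL : IsCompleteFor (fun v w : TensorCarrier E F => innerLHom v w) := by
  obtain ⟨n, e, he⟩ := exists_leftFrame E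
  obtain ⟨m, f, hf⟩ := exists_leftFrame F
  refine preInnerL.isCompleteFor_of_frame (fun p : Fin m × Fin n => tmul (e p.2) (f p.1))
    fun v => ?_
  conv_lhs => rw [eq_sum_contractL hf v]
  rw [Fintype.sum_prod_type]
  refine Finset.sum_congr rfl fun i _ => ?_
  conv_lhs => rw [he (contractL (f i) v), sum_tmul]
  simp only [star_innerLHom, innerLHom_tmul_right, leftAct_tmul]

theorem fullR : Dense (Submodule.span ℂ (Set.range fun p : TensorCarrier E F × TensorCarrier E F =>
    innerRHom p.1 p.2) : Set A) := fun a => by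
  apply subset_closure
  obtain ⟨n, e, he⟩ := E.exists_innerR_eq_one
  obtain ⟨m, f, hf⟩ := F.exists_innerR_eq_one
  have h : a = ∑ j, ∑ i, innerRHom (tmul (e i) (f j)) (tmul (e i) (f j <• a)) := by
    simp only [innerRHom_tmul, ← F.preInnerR.sum_right, ← Finset.sum_smul, he, one_smul,
      F.innerR_act_right, ← Finset.sum_mul, hf, one_mul]
  rw [h]
  exact Submodule.sum_mem _ fun j _ => Submodule.sum_mem _ fun i _ =>
    Submodule.subset_span ⟨(_, _), rfl⟩

theorem fullL : Dense (Submodule.span ℂ (Set.range fun p : TensorCarrier E F × TensorCarrier E F =>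
    innerLHom p.1 p.2) : Set A) := fun a => by
  apply subset_closure
  obtain ⟨n, e, he⟩ := E.exists_innerL_eq_one
  obtain ⟨m, f, hf⟩ := F.exists_innerL_eq_one
  have h : a = ∑ i, ∑ j, innerLHom (tmul (a •> e i) (f j)) (tmul (e i) (f j)) := by
    simp only [innerLHom_tmul, ← E.preInnerL.sum_left, ← Finset.sum_smul, ← Finset.op_sum, hf,
      MulOpposite.op_one, one_smul, E.innerL_act_left, ← Finset.mul_sum, he, mul_one]
  rw [h]
  exact Submodule.sum_mem _ fun j _ => Submodule.sum_mem _ fun i _ =>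
    Submodule.subset_span ⟨(_, _), rfl⟩

end TensorCarrier

/-- The interior tensor product `E ⊗_A F`, with `⟨x ⊗ y, x' ⊗ y'⟩_A = ⟨y, ⟨x, x'⟩_A y'⟩_A` and
`ₐ⟨x ⊗ y, x' ⊗ y'⟩ = ₐ⟨x ₐ⟨y, y'⟩, x'⟩`. In general one divides the algebraic tensor product by
the vectors of length zero and completes; since `A` is unital, the balanced algebraic tensor product
has no nonzero such vector and is complete already, as proved above. -/
noncomputable def tensor : EquivalenceBimodule A where
  carrier := TensorCarrier E F
  innerR v w := TensorCarrier.innerRHom v w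
  innerR_add_right _ _ _ := map_add _ _ _
  innerR_smul_right := TensorCarrier.innerRHom_smul
  innerR_act_right := TensorCarrier.innerRHom_act
  star_innerR := TensorCarrier.star_innerRHom
  innerR_self_nonneg := TensorCarrier.innerRHom_self_nonneg
  innerR_definite := TensorCarrier.innerRHom_definite
  completeR := TensorCarrier.completeR
  fullR := TensorCarrier.fullR
  innerL v w := TensorCarrier.innerLHom v w
  innerL_add_left v v' w := by rw [map_add, AddMonoidHom.add_apply]
  innerL_smul_left := TensorCarrier.innerLHom_smul
  innerL_act_left := TensorCarrier.innerLHom_act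
  star_innerL := TensorCarrier.star_innerLHom
  innerL_self_nonneg := TensorCarrier.innerLHom_self_nonneg
  innerL_definite := TensorCarrier.innerLHom_definite
  completeL := TensorCarrier.completeL
  fullL := TensorCarrier.fullL
  innerL_act_eq := TensorCarrier.innerLHom_act_eq

end Tensor

/-! ### Isomorphism classes -/

/-- `E` and `F` are isomorphic as equivalence bimodules. -/
def Isomorphic (E F : EquivalenceBimodule A) : Prop :=
  ∃ Φ : E.carrier ≃ₗ[ℂ] F.carrier,
    (∀ (a b : A) (x : E.carrier), Φ ((a •> x) <• b) = (a •> Φ x) <• b) ∧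
    (∀ x y, F.innerL (Φ x) (Φ y) = E.innerL x y) ∧
    (∀ x y, F.innerR (Φ x) (Φ y) = E.innerR x y)

theorem isomorphic_equivalence : Equivalence (Isomorphic (A := A)) where
  refl E := ⟨LinearEquiv.refl ℂ _, fun _ _ _ => rfl, fun _ _ => rfl, fun _ _ => rfl⟩
  symm := by
    rintro E F ⟨Φ, h1, h2, h3⟩
    refine ⟨Φ.symm, fun a b x => ?_, fun x y => ?_, fun x y => ?_⟩
    · rw [LinearEquiv.symm_apply_eq, h1, LinearEquiv.apply_symm_apply]
    · rw [← h2, LinearEquiv.apply_symm_apply, LinearEquiv.apply_symm_apply]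
    · rw [← h3, LinearEquiv.apply_symm_apply, LinearEquiv.apply_symm_apply]
  trans := by
    rintro E F G ⟨Φ, h1, h2, h3⟩ ⟨Ψ, k1, k2, k3⟩
    refine ⟨Φ.trans Ψ, fun a b x => ?_, fun x y => ?_, fun x y => ?_⟩
    · simp only [LinearEquiv.trans_apply, h1, k1]
    · simp only [LinearEquiv.trans_apply, k2, h2]
    · simp only [LinearEquiv.trans_apply, k3, h3]

/-- A surjection compatible with all the structure is an isomorphism. -/
theorem Isomorphic.of_surjective {E F : EquivalenceBimodule A} (Φ : E.carrier →+ F.carrier)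
    (hs : Function.Surjective Φ) (hl : ∀ (a : A) x, Φ (a •> x) = a •> Φ x)
    (hr : ∀ (a : A) x, Φ (x <• a) = Φ x <• a)
    (hL : ∀ x y, F.innerL (Φ x) (Φ y) = E.innerL x y)
    (hR : ∀ x y, F.innerR (Φ x) (Φ y) = E.innerR x y) : Isomorphic E F := by
  have hc : ∀ (c : ℂ) x, Φ (c • x) = c • Φ x := fun c x => by
    simpa using hl (c • (1 : A)) x
  have hi : Function.Injective Φ := by
    refine (injective_iff_map_eq_zero Φ).2 fun x hx => E.innerR_definite x ?_
    rw [← hR, hx]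
    exact map_zero (F.preInnerR.homRight 0)
  refine ⟨LinearEquiv.ofBijective { toFun := Φ, map_add' := map_add Φ, map_smul' := hc } ⟨hi, hs⟩,
    fun a b x => ?_, hL, hR⟩
  change Φ _ = (a •> Φ x) <• b
  rw [hr, hl]

theorem Isomorphic.tensor {E E' F F' : EquivalenceBimodule A} (h : Isomorphic E E')
    (k : Isomorphic F F') : Isomorphic (E.tensor F) (E'.tensor F') := by
  obtain ⟨Φ, h1, h2, h3⟩ := h
  obtain ⟨Ψ, k1, k2, k3⟩ := k
  have hl : ∀ (a : A) x, Φ (a •> x) = a •> Φ x := fun a x => by simpa using h1 a 1 x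
  have hr : ∀ (a : A) x, Φ (x <• a) = Φ x <• a := fun a x => by simpa using h1 1 a x
  have kl : ∀ (a : A) x, Ψ (a •> x) = a •> Ψ x := fun a x => by simpa using k1 a 1 x
  have kr : ∀ (a : A) x, Ψ (x <• a) = Ψ x <• a := fun a x => by simpa using k1 1 a x
  let Θ : TensorCarrier E F →+ TensorCarrier E' F' :=
    TensorCarrier.liftHom (fun x y => TensorCarrier.tmul (Φ x) (Ψ y))
      (fun x x' y => by rw [map_add, TensorCarrier.add_tmul])
      (fun x y y' => by rw [map_add, TensorCarrier.tmul_add])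
      (fun x a y => by rw [hr, kl, TensorCarrier.act_tmul])
  have hΘ : ∀ x y, Θ (TensorCarrier.tmul x y) = TensorCarrier.tmul (Φ x) (Ψ y) := fun _ _ => rfl
  have p1 : Function.Surjective Θ := by
    intro v
    induction v using TensorCarrier.induction with
    | tmul x y => exact ⟨TensorCarrier.tmul (Φ.symm x) (Ψ.symm y), by simp [hΘ]⟩
    | add v w hv hw =>
      obtain ⟨v, rfl⟩ := hv
      obtain ⟨w, rfl⟩ := hw
      exact ⟨v + w, map_add Θ v w⟩
  have p2 : ∀ (a : A) (v : TensorCarrier E F), Θ (a •> v) = a •> Θ v := by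
    intro a v
    induction v using TensorCarrier.induction with
    | tmul x y => rw [TensorCarrier.leftAct_tmul, hΘ, hΘ, TensorCarrier.leftAct_tmul, hl]
    | add v w hv hw => rw [smul_add, map_add, map_add, smul_add, hv, hw]
  have p3 : ∀ (a : A) (v : TensorCarrier E F), Θ (v <• a) = Θ v <• a := by
    intro a v
    induction v using TensorCarrier.induction with
    | tmul x y => rw [TensorCarrier.rightAct_tmul, hΘ, hΘ, TensorCarrier.rightAct_tmul, kr]
    | add v w hv hw => rw [smul_add, map_add, map_add, smul_add, hv, hw]
  have p4 : ∀ v w : TensorCarrier E F,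
      TensorCarrier.innerLHom (Θ v) (Θ w) = TensorCarrier.innerLHom v w := by
    intro v w
    induction v using TensorCarrier.induction with
    | tmul x y =>
      induction w using TensorCarrier.induction with
      | tmul x' y' =>
        rw [hΘ, hΘ, TensorCarrier.innerLHom_tmul, TensorCarrier.innerLHom_tmul, k2, ← hr, h2]
      | add v w hv hw => rw [map_add, map_add, map_add, hv, hw]
    | add v v' hv hv' =>
      rw [map_add, map_add, map_add, AddMonoidHom.add_apply, AddMonoidHom.add_apply, hv, hv']
  have p5 : ∀ v w : TensorCarrier E F,
      TensorCarrier.innerRHom (Θ v) (Θ w) = TensorCarrier.innerRHom v w := by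
    intro v w
    induction v using TensorCarrier.induction with
    | tmul x y =>
      induction w using TensorCarrier.induction with
      | tmul x' y' =>
        rw [hΘ, hΘ, TensorCarrier.innerRHom_tmul, TensorCarrier.innerRHom_tmul, h3, ← kl, k3]
      | add v w hv hw => rw [map_add, map_add, map_add, hv, hw]
    | add v v' hv hv' =>
      rw [map_add, map_add, map_add, AddMonoidHom.add_apply, AddMonoidHom.add_apply, hv, hv']
  exact Isomorphic.of_surjective (E := E.tensor F) (F := E'.tensor F') Θ p1 p2 p3 p4 p5

/-- The setoid of isomorphism of equivalence bimodules. -/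
def setoid (A : Type u) [CStarAlgebra A] [PartialOrder A] [StarOrderedRing A] :
    Setoid (EquivalenceBimodule A) := ⟨Isomorphic, isomorphic_equivalence⟩

end EquivalenceBimodule

/-- `Pic(A)`, the set of isomorphism classes of `A`-`A`-equivalence bimodules. Its product and unit
are defined below. -/
def Pic (A : Type u) [CStarAlgebra A] [PartialOrder A] [StarOrderedRing A] : Type (u + 1) :=
  Quotient (EquivalenceBimodule.setoid A)

namespace Pic

variable {A : Type u} [CStarAlgebra A] [PartialOrder A] [StarOrderedRing A]

/-- The class `[E]` of an equivalence bimodule. -/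
def mk (E : EquivalenceBimodule A) : Pic A := Quotient.mk (EquivalenceBimodule.setoid A) E

/-- `[E] [F] = [E ⊗_A F]`. -/
noncomputable instance : Mul (Pic A) :=
  ⟨Quotient.map₂ EquivalenceBimodule.tensor fun _ _ h _ _ k => h.tensor k⟩

/-- The unit is the class of the identity bimodule. -/
noncomputable instance : One (Pic A) := ⟨mk (EquivalenceBimodule.identity A)⟩

theorem mk_mul_mk (E F : EquivalenceBimodule A) : mk E * mk F = mk (E.tensor F) := rfl

theorem one_def : (1 : Pic A) = mk (EquivalenceBimodule.identity A) := rfl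

end Pic

/-- A unital C⋆-algebra is simple if it is nonzero and has only the two trivial closed two-sided
ideals. -/
def IsSimpleCStarAlgebra (A : Type*) [CStarAlgebra A] : Prop :=
  Nontrivial A ∧ ∀ I : TwoSidedIdeal A, IsClosed (I : Set A) → I = ⊥ ∨ I = ⊤

/-- A normalized trace (tracial state) on a unital C⋆-algebra. -/
structure IsNormalizedTrace {A : Type*} [CStarAlgebra A] [PartialOrder A] (τ : A →ₗ[ℂ] ℂ) :
    Prop where
  nonneg : ∀ a, 0 ≤ a → 0 ≤ τ a
  trace : ∀ a b, τ (a * b) = τ (b * a)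
  map_one : τ 1 = 1

/-!
A tracial state `τ` is transported along an equivalence bimodule `E`. For a finite basis `ξ` of `E`
put `φ a = ∑ᵢ τ ⟨ξᵢ, a ξᵢ⟩_A` (`EquivalenceBimodule.inducedTrace`), so that the sum in question is
`φ 1`. Expanding in the basis and using that `τ` is a trace gives
`φ ₐ⟨x, y⟩ = τ ⟨y, x⟩_A` (`IsFiniteBasis.inducedTrace_innerL`). Since the elements `ₐ⟨x, y⟩` add up
to every element of `A`, the functional `φ` does not depend on the basis
(`IsFiniteBasis.inducedTrace_eq`). It is positive and tracial, and `φ 1 > 0`: otherwise `φ`, being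
positive, vanishes, hence so does `τ` on all `⟨x, x⟩_A`, although some of these add up to `1`.

If `τ` is the only tracial state, then `φ / φ 1` is `τ`, that is, `φ = φ 1 • τ`
(`IsFiniteBasis.inducedTrace_eq_smul`). For bases `ξ` of `E` and `η` of `F`, the elementary tensors
`ξᵢ ⊗ ηⱼ` form a basis of `E ⊗_A F`, and
`∑ᵢⱼ τ ⟨ηⱼ, ⟨ξᵢ, ξᵢ⟩_A ηⱼ⟩_A = φ_F (∑ᵢ ⟨ξᵢ, ξᵢ⟩_A) = φ_F 1 * φ_E 1`, which is multiplicativity.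
-/

namespace EquivalenceBimodule

variable {A : Type u} [CStarAlgebra A] [PartialOrder A] [StarOrderedRing A]
  {E F : EquivalenceBimodule A} {τ : A →ₗ[ℂ] ℂ} {n m : ℕ}

/-- The functional `a ↦ ∑ᵢ τ ⟨ξᵢ, a ξᵢ⟩_A` attached to a functional `τ` on `A` and a finite family
`ξ` in `E`. -/
noncomputable def inducedTrace (E : EquivalenceBimodule A) (τ : A →ₗ[ℂ] ℂ) (ξ : Fin n → E.carrier) :
    A →ₗ[ℂ] ℂ where
  toFun a := ∑ i, τ (E.innerR (ξ i) (a •> ξ i))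
  map_add' a b := by
    simp only [add_smul, E.innerR_add_right, map_add, Finset.sum_add_distrib]
  map_smul' c a := by
    simp only [smul_assoc, E.innerR_smul_right, map_smul, Finset.smul_sum, RingHom.id_apply]

theorem inducedTrace_apply (ξ : Fin n → E.carrier) (a : A) :
    E.inducedTrace τ ξ a = ∑ i, τ (E.innerR (ξ i) (a •> ξ i)) := rfl

theorem inducedTrace_one (ξ : Fin n → E.carrier) :
    E.inducedTrace τ ξ 1 = ∑ i, τ (E.innerR (ξ i) (ξ i)) := by
  simp only [inducedTrace_apply, one_smul]

theorem inducedTrace_nonneg (hτ : IsNormalizedTrace τ) (ξ : Fin n → E.carrier) {a : A}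
    (ha : 0 ≤ a) : 0 ≤ E.inducedTrace τ ξ a := by
  obtain ⟨b, rfl⟩ := CStarAlgebra.nonneg_iff_eq_star_mul_self.1 ha
  refine Finset.sum_nonneg fun i _ => hτ.nonneg _ ?_
  rw [mul_smul, ← E.innerR_leftAct]
  exact E.innerR_self_nonneg _

theorem IsFiniteBasis.innerR_eq_sum {ξ : Fin n → E.carrier} (hξ : E.IsFiniteBasis ξ)
    (x y : E.carrier) : E.innerR x y = ∑ i, E.innerR x (ξ i) * E.innerR (ξ i) y := by
  conv_lhs => rw [hξ y, E.preInnerR.sum_right]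
  simp only [E.innerR_act_right]

/-- The induced trace evaluates a left inner product as `τ` evaluates the corresponding right one,
with the arguments exchanged. -/
theorem IsFiniteBasis.inducedTrace_innerL (hτ : IsNormalizedTrace τ) {ξ : Fin n → E.carrier}
    (hξ : E.IsFiniteBasis ξ) (x y : E.carrier) :
    E.inducedTrace τ ξ (E.innerL x y) = τ (E.innerR y x) := by
  simp only [inducedTrace_apply, E.innerL_act_eq, E.innerR_act_right]
  rw [hξ.innerR_eq_sum y x, map_sum]
  exact Finset.sum_congr rfl fun i _ => hτ.trace _ _

theorem IsFiniteBasis.inducedTrace_eq (hτ : IsNormalizedTrace τ) {ξ : Fin n → E.carrier}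
    {ζ : Fin m → E.carrier} (hξ : E.IsFiniteBasis ξ) (hζ : E.IsFiniteBasis ζ) :
    E.inducedTrace τ ξ = E.inducedTrace τ ζ := by
  obtain ⟨k, e, he⟩ := E.exists_innerL_eq_one
  ext a
  have ha : a = ∑ i, E.innerL (a •> e i) (e i) := by
    simp only [E.innerL_act_left, ← Finset.mul_sum, he, mul_one]
  rw [ha, map_sum, map_sum]
  simp only [hξ.inducedTrace_innerL hτ, hζ.inducedTrace_innerL hτ]

theorem IsFiniteBasis.inducedTrace_mul_comm (hτ : IsNormalizedTrace τ) {ξ : Fin n → E.carrier}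
    (hξ : E.IsFiniteBasis ξ) (a b : A) :
    E.inducedTrace τ ξ (a * b) = E.inducedTrace τ ξ (b * a) := by
  have key : ∀ a b : A, E.inducedTrace τ ξ (a * b) =
      ∑ i, ∑ j, τ (E.innerR (ξ i) (a •> ξ j) * E.innerR (ξ j) (b •> ξ i)) := fun a b => by
    rw [inducedTrace_apply]
    refine Finset.sum_congr rfl fun i _ => ?_
    rw [mul_smul, ← star_star a, ← E.innerR_leftAct, hξ.innerR_eq_sum, map_sum]
    simp only [E.innerR_leftAct]
  rw [key, key, Finset.sum_comm]
  exact Finset.sum_congr rfl fun i _ => Finset.sum_congr rfl fun j _ => hτ.trace _ _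

theorem IsFiniteBasis.inducedTrace_one_pos (hτ : IsNormalizedTrace τ) {ξ : Fin n → E.carrier}
    (hξ : E.IsFiniteBasis ξ) : 0 < E.inducedTrace τ ξ 1 := by
  refine lt_of_le_of_ne (inducedTrace_nonneg hτ ξ zero_le_one) fun h0 => ?_
  have hzero : ∀ a : A, 0 ≤ a → E.inducedTrace τ ξ a = 0 := by
    intro a ha
    refine le_antisymm ?_ (inducedTrace_nonneg hτ ξ ha)
    -- positivity of the functional at `‖a‖ • 1 - a`
    have hle : 0 ≤ ((‖a‖ : ℝ) : ℂ) • (1 : A) - a := by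
      rw [sub_nonneg]
      have := IsSelfAdjoint.le_algebraMap_norm_self (a := a) ha.isSelfAdjoint
      rwa [Algebra.algebraMap_eq_smul_one, ← Complex.coe_smul] at this
    have h := inducedTrace_nonneg hτ ξ hle
    rwa [map_sub, map_smul, ← h0, smul_zero, sub_nonneg] at h
  obtain ⟨k, e, he⟩ := E.exists_innerR_eq_one
  have h1 : τ 1 = 0 := by
    rw [← he, map_sum]
    refine Finset.sum_eq_zero fun i _ => ?_
    rw [← hξ.inducedTrace_innerL hτ]
    exact hzero _ (E.innerL_self_nonneg _)
  exact one_ne_zero (hτ.map_one.symm.trans h1)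

/-- If `τ` is the only tracial state, then every induced trace is a multiple of `τ`. -/
theorem IsFiniteBasis.inducedTrace_eq_smul (hτ : IsNormalizedTrace τ)
    (hunique : ∀ τ' : A →ₗ[ℂ] ℂ, IsNormalizedTrace τ' → τ' = τ) {ξ : Fin n → E.carrier}
    (hξ : E.IsFiniteBasis ξ) : E.inducedTrace τ ξ = E.inducedTrace τ ξ 1 • τ := by
  have hpos := hξ.inducedTrace_one_pos hτ
  have h : IsNormalizedTrace ((E.inducedTrace τ ξ 1)⁻¹ • E.inducedTrace τ ξ) :=
    { nonneg := fun a ha => mul_nonneg (inv_nonneg.2 hpos.le) (inducedTrace_nonneg hτ ξ ha)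
      trace := fun a b =>
        congrArg ((E.inducedTrace τ ξ 1)⁻¹ * ·) (hξ.inducedTrace_mul_comm hτ a b)
      map_one := inv_mul_cancel₀ hpos.ne' }
  exact (inv_smul_eq_iff₀ hpos.ne').1 (hunique _ h)

theorem IsFiniteBasis.tensor {ξ : Fin n → E.carrier} {η : Fin m → F.carrier}
    (hξ : E.IsFiniteBasis ξ) (hη : F.IsFiniteBasis η) :
    (E.tensor F).IsFiniteBasis fun k : Fin (n * m) =>
      TensorCarrier.tmul (ξ (finProdFinEquiv.symm k).1) (η (finProdFinEquiv.symm k).2) := by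
  intro (v : TensorCarrier E F)
  have h : v = ∑ p : Fin n × Fin m, TensorCarrier.tmul (ξ p.1) (η p.2) <•
      TensorCarrier.innerRHom (TensorCarrier.tmul (ξ p.1) (η p.2)) v := by
    conv_lhs => rw [TensorCarrier.eq_sum_contractR hξ v]
    rw [Fintype.sum_prod_type]
    refine Finset.sum_congr rfl fun i _ => ?_
    conv_lhs => rw [hη (TensorCarrier.contractR (ξ i) v), TensorCarrier.tmul_sum]
    simp only [TensorCarrier.innerRHom_tmul_left, TensorCarrier.rightAct_tmul]
  conv_lhs => rw [h]
  exact (Equiv.sum_comp finProdFinEquiv.symm _).symm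

theorem IsFiniteBasis.inducedTrace_tensor_one (hτ : IsNormalizedTrace τ)
    (hunique : ∀ τ' : A →ₗ[ℂ] ℂ, IsNormalizedTrace τ' → τ' = τ) {ξ : Fin n → E.carrier}
    {η : Fin m → F.carrier} (hη : F.IsFiniteBasis η) :
    ((E.tensor F).inducedTrace τ fun k : Fin (n * m) =>
      TensorCarrier.tmul (ξ (finProdFinEquiv.symm k).1) (η (finProdFinEquiv.symm k).2)) 1 =
      E.inducedTrace τ ξ 1 * F.inducedTrace τ η 1 := by
  refine (inducedTrace_one _).trans ?_
  calc _ = ∑ p : Fin n × Fin m, τ (F.innerR (η p.2) (E.innerR (ξ p.1) (ξ p.1) •> η p.2)) :=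
        Equiv.sum_comp finProdFinEquiv.symm fun p : Fin n × Fin m =>
          τ (F.innerR (η p.2) (E.innerR (ξ p.1) (ξ p.1) •> η p.2))
    _ = ∑ i, F.inducedTrace τ η (E.innerR (ξ i) (ξ i)) := Fintype.sum_prod_type _
    _ = _ := by
      rw [hη.inducedTrace_eq_smul hτ hunique, inducedTrace_one ξ, Finset.sum_mul]
      refine Finset.sum_congr rfl fun i _ => ?_
      rw [LinearMap.smul_apply, LinearMap.smul_apply, hτ.map_one, smul_eq_mul, smul_eq_mul,
        mul_one, mul_comm]

theorem isFiniteBasis_identity : (identity A).IsFiniteBasis fun _ : Fin 1 => (1 : A) := by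
  intro (a : A)
  change a = ∑ _i : Fin 1, (1 : A) * (star 1 * a)
  simp

/-- `E.traceDim τ` is the real number `∑ᵢ τ ⟨ξᵢ, ξᵢ⟩_A` for a chosen finite basis `ξ` of `E`. -/
noncomputable def traceDim (E : EquivalenceBimodule A) (τ : A →ₗ[ℂ] ℂ) : ℝ :=
  (E.inducedTrace τ (TensorCarrier.exists_finiteBasis E).choose_spec.choose 1).re

theorem IsFiniteBasis.traceDim_eq (hτ : IsNormalizedTrace τ) {ξ : Fin n → E.carrier}
    (hξ : E.IsFiniteBasis ξ) : (E.traceDim τ : ℂ) = E.inducedTrace τ ξ 1 := by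
  rw [traceDim, IsFiniteBasis.inducedTrace_eq hτ
    (TensorCarrier.exists_finiteBasis E).choose_spec.choose_spec hξ]
  exact (Complex.eq_re_of_ofReal_le (hξ.inducedTrace_one_pos hτ).le).symm

theorem traceDim_pos (hτ : IsNormalizedTrace τ) (E : EquivalenceBimodule A) :
    0 < E.traceDim τ := by
  obtain ⟨n, ξ, hξ⟩ := TensorCarrier.exists_finiteBasis E
  have h := hξ.inducedTrace_one_pos hτ
  rwa [← hξ.traceDim_eq hτ, Complex.zero_lt_real] at h

theorem Isomorphic.traceDim_eq (hτ : IsNormalizedTrace τ) (h : Isomorphic E F) :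
    E.traceDim τ = F.traceDim τ := by
  obtain ⟨Φ, h1, -, h3⟩ := h
  obtain ⟨n, ξ, hξ⟩ := TensorCarrier.exists_finiteBasis E
  have hΦ : F.IsFiniteBasis fun i => Φ (ξ i) := by
    intro η
    obtain ⟨x, rfl⟩ := Φ.surjective η
    have hr : ∀ (a : A) x, Φ (x <• a) = Φ x <• a := fun a x => by simpa using h1 1 a x
    conv_lhs => rw [hξ x, map_sum]
    simp only [hr, h3]
  apply Complex.ofReal_injective
  rw [hξ.traceDim_eq hτ, hΦ.traceDim_eq hτ, inducedTrace_one, inducedTrace_one]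
  simp only [h3]

theorem traceDim_tensor (hτ : IsNormalizedTrace τ)
    (hunique : ∀ τ' : A →ₗ[ℂ] ℂ, IsNormalizedTrace τ' → τ' = τ) (E F : EquivalenceBimodule A) :
    (E.tensor F).traceDim τ = E.traceDim τ * F.traceDim τ := by
  obtain ⟨n, ξ, hξ⟩ := TensorCarrier.exists_finiteBasis E
  obtain ⟨m, η, hη⟩ := TensorCarrier.exists_finiteBasis F
  apply Complex.ofReal_injective
  rw [Complex.ofReal_mul, hξ.traceDim_eq hτ, hη.traceDim_eq hτ, (hξ.tensor hη).traceDim_eq hτ,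
    hη.inducedTrace_tensor_one hτ hunique]

theorem traceDim_identity (hτ : IsNormalizedTrace τ) : (identity A).traceDim τ = 1 := by
  apply Complex.ofReal_injective
  refine (isFiniteBasis_identity.traceDim_eq hτ).trans ((inducedTrace_one _).trans ?_)
  change ∑ _i : Fin 1, τ (star (1 : A) * 1) = _
  simp [hτ.map_one]

end EquivalenceBimodule

theorem mainTheorem2 {A : Type u} [CStarAlgebra A] [PartialOrder A] [StarOrderedRing A]
    (hA : IsSimpleCStarAlgebra A) (τ : A →ₗ[ℂ] ℂ) (hτ : IsNormalizedTrace τ)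
    (hunique : ∀ τ' : A →ₗ[ℂ] ℂ, IsNormalizedTrace τ' → τ' = τ) :
    -- every equivalence bimodule has a finite basis
    (∀ E : EquivalenceBimodule A, ∃ (n : ℕ) (ξ : Fin n → E.carrier), E.IsFiniteBasis ξ) ∧
    -- the sum does not depend on the basis
    (∀ (E : EquivalenceBimodule A) (n m : ℕ) (ξ : Fin n → E.carrier) (ζ : Fin m → E.carrier),
      E.IsFiniteBasis ξ → E.IsFiniteBasis ζ →
        ∑ i, τ (E.innerR (ξ i) (ξ i)) = ∑ k, τ (E.innerR (ζ k) (ζ k))) ∧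
    -- it defines a map from `Pic A` to the positive reals, which is multiplicative and unital
    ∃ T : Pic A → {r : ℝ // 0 < r},
      (∀ (E : EquivalenceBimodule A) (n : ℕ) (ξ : Fin n → E.carrier), E.IsFiniteBasis ξ →
        ((T (Pic.mk E) : ℝ) : ℂ) = ∑ i, τ (E.innerR (ξ i) (ξ i))) ∧
      (∀ x y : Pic A, T (x * y) = T x * T y) ∧
      T (Pic.mk (EquivalenceBimodule.identity A)) = 1 := by
  refine ⟨EquivalenceBimodule.TensorCarrier.exists_finiteBasis, fun E n m ξ ζ hξ hζ => ?_,
    Quotient.lift (fun E => ⟨E.traceDim τ, E.traceDim_pos hτ⟩)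
      fun E F h => Subtype.ext (EquivalenceBimodule.Isomorphic.traceDim_eq hτ h), ?_, ?_, ?_⟩
  · rw [← EquivalenceBimodule.inducedTrace_one, ← EquivalenceBimodule.inducedTrace_one,
      hξ.inducedTrace_eq hτ hζ]
  · intro E n ξ hξ
    rw [← EquivalenceBimodule.inducedTrace_one]
    exact hξ.traceDim_eq hτ
  · intro x y
    induction x using Quotient.inductionOn with
    | h E =>
      induction y using Quotient.inductionOn with
      | h F => exact Subtype.ext (EquivalenceBimodule.traceDim_tensor hτ hunique E F)
  · exact Subtype.ext (EquivalenceBimodule.traceDim_identity hτ)
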